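/- All algebras are complex. A Fréchet algebra is a (not necessarily unital) algebra $A$ with a complete Hausdorff topology generated by an increasing sequence $(p_k)$ of submultiplicative seminorms. Put $A^{(0)}=A$ and let $A^{(n+1)}$ be the strong dual of $A^{(n)}$ (continuous linear functionals with uniform convergence on bounded sets), an $A$-bimodule via $\langle a\cdot f,x\rangle=\langle f,x\cdot a\rangle$ and $\langle f\cdot a,x\rangle=\langle f,a\cdot x\rangle$. The algebra $A$ is $n$-weakly amenable if every continuous derivation $D\colon A\to A^{(n)}$, i.e. every continuous linear map with $D(ab)=a\cdot D(b)+D(a)\cdot b$, is inner, i.e. of the form $D(a)=a\cdot x-x\cdot a$ for some $x\in A^{(n)}$; weakly amenable means $1$-weakly amenable. The unitization of $A$ is the Fréchet algebra $A^{\#}=A\oplus\mathbb{C}e$ with product $(a,\lambda)(b,\mu)=(ab+\mu a+\lambda b,\lambda\mu)$ and seminorms $q_k(a,\lambda)=p_k(a)+|\lambda|$. A bounded approximate identity of $A$ is a bounded net $(e_\alpha)$ in $A$ with $e_\alpha a\to a$ and $ae_\alpha\to a$ for all $a\in A$. Theorem. Let $A$ be a Fréchet algebra that is either weakly amenable or has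 a bounded approximate identity. Then, for every integer $n\ge 0$, the unitization $A^{\#}$ is $n$-weakly amenable if and only if $A$ is $n$-weakly amenable. -/

import Mathlib

open Topology

universe u

/-- A complex **Fréchet algebra**: a complete Hausdorff topological algebra whose topology is
generated by an increasing sequence of submultiplicative seminorms. The algebra is neither
assumed to be unital nor commutative. The bilinearity of the product, `IsScalarTower ℂ A A` and
`SMulCommClass ℂ A A`, is assumed separately. -/
class IsFrechetAlgebra (A : Type u) [NonUnitalRing A] [Module ℂ A] [UniformSpace A] : Prop
    extends IsUniformAddGroup A, CompleteSpace A, T2Space A where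
  exists_seminorms : ∃ p : ℕ → Seminorm ℂ A, Monotone p ∧
    (∀ n x y, p n (x * y) ≤ p n x * p n y) ∧ WithSeminorms p

section FrechetAlgebra

variable (A : Type u) [NonUnitalRing A] [Module ℂ A] [UniformSpace A]

instance IsFrechetAlgebra.continuousSMul [IsFrechetAlgebra A] : ContinuousSMul ℂ A := by
  obtain ⟨p, -, -, hp⟩ := IsFrechetAlgebra.exists_seminorms (A := A)
  exact hp.continuousSMul

variable [IsScalarTower ℂ A A] [SMulCommClass ℂ A A]

/-- Multiplication by a fixed element of a Fréchet algebra is continuous on either side. -/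
theorem IsFrechetAlgebra.continuous_mul_left_right [IsFrechetAlgebra A] (a : A) :
    Continuous (fun x : A => a * x) ∧ Continuous (fun x : A => x * a) := by
  obtain ⟨p, -, hmul, hp⟩ := IsFrechetAlgebra.exists_seminorms (A := A)
  constructor
  · refine hp.continuous_of_isBounded hp (LinearMap.mulLeft ℂ a) fun n => ?_
    refine ⟨{n}, ⟨p n a, apply_nonneg _ _⟩, fun x => ?_⟩
    rw [Finset.sup_singleton]
    exact hmul n a x
  · refine hp.continuous_of_isBounded hp (LinearMap.mulRight ℂ a) fun n => ?_
    refine ⟨{n}, ⟨p n a, apply_nonneg _ _⟩, fun x => ?_⟩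
    rw [Finset.sup_singleton]
    exact (hmul n x a).trans_eq (mul_comm (p n x) (p n a))

end FrechetAlgebra

section Unitization

variable (A : Type u) [NonUnitalRing A] [Module ℂ A]

/-- The unitization `A^# = ℂ e ⊕ A` carries the product uniformity (and topology). -/
noncomputable instance unitizationUniformSpace [UniformSpace A] : UniformSpace (Unitization ℂ A) :=
  instUniformSpaceProd.comap (Unitization.addEquiv ℂ A)

variable {A}

/-- The seminorm `q (a + l e) = p a + |l|` on the unitization. -/
noncomputable def unitizationSeminorm (p : Seminorm ℂ A) : Seminorm ℂ (Unitization ℂ A) :=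
  p.comp (Unitization.sndHom ℂ ℂ A) +
    (normSeminorm ℂ ℂ).comp ((LinearMap.fst ℂ ℂ A).comp (Unitization.linearEquiv ℂ ℂ A).toLinearMap)

theorem unitizationSeminorm_apply (p : Seminorm ℂ A) (x : Unitization ℂ A) :
    unitizationSeminorm p x = p x.snd + ‖x.fst‖ := rfl

instance unitizationIsUniformAddGroup [UniformSpace A] [IsUniformAddGroup A] :
    IsUniformAddGroup (Unitization ℂ A) :=
  IsUniformAddGroup.comap (Unitization.addEquiv ℂ A)

/-- The topology of the unitization is the one generated by the seminorms `q n`. -/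
theorem unitization_withSeminorms [UniformSpace A] [IsUniformAddGroup A] {p : ℕ → Seminorm ℂ A}
    (hp : WithSeminorms p) : WithSeminorms (fun n => unitizationSeminorm (p n)) := by
  have key : ∀ n, (𝓝 (0 : ℝ)).comap (unitizationSeminorm (p n)) =
      ((𝓝 (0 : ℝ)).comap (p n)).comap (fun x : Unitization ℂ A => x.snd) ⊓ (𝓝 (0 : ℂ)).comap (fun x : Unitization ℂ A => x.fst) := by
    intro n
    rw [Filter.comap_comap]
    refine le_antisymm (le_inf ?_ ?_) ?_
    · rw [← Filter.tendsto_iff_comap]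
      exact squeeze_zero (fun x => apply_nonneg _ _)
        (fun x => le_add_of_nonneg_right (norm_nonneg x.fst)) Filter.tendsto_comap
    · rw [← Filter.tendsto_iff_comap]
      exact squeeze_zero_norm (fun x => le_add_of_nonneg_left (apply_nonneg (p n) x.snd))
        Filter.tendsto_comap
    · rw [← Filter.tendsto_iff_comap]
      have h1 : Filter.Tendsto (fun x : Unitization ℂ A => p n x.snd)
          ((𝓝 (0 : ℝ)).comap (p n ∘ (fun x : Unitization ℂ A => x.snd)) ⊓ (𝓝 (0 : ℂ)).comap (fun x : Unitization ℂ A => x.fst))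
          (𝓝 0) := Filter.tendsto_comap.mono_left inf_le_left
      have h2 : Filter.Tendsto (fun x : Unitization ℂ A => x.fst)
          ((𝓝 (0 : ℝ)).comap (p n ∘ (fun x : Unitization ℂ A => x.snd)) ⊓ (𝓝 (0 : ℂ)).comap (fun x : Unitization ℂ A => x.fst))
          (𝓝 0) := Filter.tendsto_comap.mono_left inf_le_right
      have h3 := h1.add h2.norm
      rw [norm_zero, add_zero] at h3
      exact h3
  have h0 : 𝓝 (0 : Unitization ℂ A) = (𝓝 (0 : A)).comap (fun x : Unitization ℂ A => x.snd) ⊓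
      (𝓝 (0 : ℂ)).comap (fun x : Unitization ℂ A => x.fst) := by
    have h : 𝓝 (0 : Unitization ℂ A) =
        (𝓝 ((0 : ℂ), (0 : A))).comap (Unitization.addEquiv ℂ A) := nhds_induced _ _
    rw [h, nhds_prod_eq, Filter.prod_eq_inf, Filter.comap_inf, Filter.comap_comap,
      Filter.comap_comap, inf_comm]
    rfl
  rw [SeminormFamily.withSeminorms_iff_nhds_eq_iInf, h0,
    (SeminormFamily.withSeminorms_iff_nhds_eq_iInf p).1 hp, Filter.comap_iInf, iInf_inf]
  exact iInf_congr fun n => (key n).symm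

/-- The unitization of a Fréchet algebra is a Fréchet algebra. -/
instance unitizationIsFrechetAlgebra [IsScalarTower ℂ A A] [SMulCommClass ℂ A A]
    [UniformSpace A] [IsFrechetAlgebra A] : IsFrechetAlgebra (Unitization ℂ A) where
  toCompleteSpace := by
    let e : Unitization ℂ A ≃ᵤ ℂ × A :=
      Equiv.toUniformEquivOfIsUniformInducing (Unitization.addEquiv ℂ A).toEquiv ⟨rfl⟩
    exact e.completeSpace_iff.2 inferInstance
  toT2Space := by
    let e : Unitization ℂ A ≃ᵤ ℂ × A :=
      Equiv.toUniformEquivOfIsUniformInducing (Unitization.addEquiv ℂ A).toEquiv ⟨rfl⟩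
    exact e.symm.toHomeomorph.t2Space
  exists_seminorms := by
    obtain ⟨p, hmono, hmul, hp⟩ := IsFrechetAlgebra.exists_seminorms (A := A)
    refine ⟨fun n => unitizationSeminorm (p n), ?_, ?_, unitization_withSeminorms hp⟩
    · intro m n hmn x
      simp only [unitizationSeminorm_apply]
      have := hmono hmn x.snd
      simpa using this
    · intro n x y
      simp only [unitizationSeminorm_apply, Unitization.snd_mul, Unitization.fst_mul, norm_mul]
      have h1 := map_add_le_add (p n) (x.fst • y.snd + y.fst • x.snd) (x.snd * y.snd)
      have h2 := map_add_le_add (p n) (x.fst • y.snd) (y.fst • x.snd)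
      have h3 := hmul n x.snd y.snd
      rw [map_smul_eq_mul, map_smul_eq_mul] at h2
      nlinarith

end Unitization

/-- A topological vector space over `ℂ` with an algebraic bimodule structure over `A` such that
every element of `A` acts by a continuous operator on either side (the standing requirement under
which the strong dual is again such a bimodule): `lact a x` is `a · x` and `ract a x` is `x · a`. -/
structure TopBimodule (A : Type u) [NonUnitalRing A] [Module ℂ A] where
  carrier : Type u
  [addCommGroup : AddCommGroup carrier]
  [module : Module ℂ carrier]
  [topology : TopologicalSpace carrier]
  [isTopologicalAddGroup : IsTopologicalAddGroup carrier]
  [continuousSMul : ContinuousSMul ℂ carrier]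
  lact : A →ₗ[ℂ] carrier →L[ℂ] carrier
  ract : A →ₗ[ℂ] carrier →L[ℂ] carrier
  lact_mul : ∀ a b x, lact (a * b) x = lact a (lact b x)
  ract_mul : ∀ a b x, ract (a * b) x = ract b (ract a x)
  lact_ract : ∀ a b x, lact a (ract b x) = ract b (lact a x)

namespace TopBimodule

attribute [instance] addCommGroup module topology isTopologicalAddGroup continuousSMul

section

variable {A : Type u} [NonUnitalRing A] [Module ℂ A]

/-- The dual bimodule: continuous linear functionals with the strong topology (uniform convergence
on bounded sets), `⟨a · f, x⟩ = ⟨f, x · a⟩` and `⟨f · a, x⟩ = ⟨f, a · x⟩`. -/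
noncomputable def dual (X : TopBimodule A) : TopBimodule A where
  carrier := StrongDual ℂ X.carrier
  lact :=
    { toFun := fun a => ContinuousLinearMap.precomp ℂ (X.ract a)
      map_add' := fun a b => by ext f x; simp
      map_smul' := fun c a => by ext f x; simp }
  ract :=
    { toFun := fun a => ContinuousLinearMap.precomp ℂ (X.lact a)
      map_add' := fun a b => by ext f x; simp
      map_smul' := fun c a => by ext f x; simp }
  lact_mul a b f := by ext x; simp [X.ract_mul]
  ract_mul a b f := by ext x; simp [X.lact_mul]
  lact_ract a b f := by ext x; simp [X.lact_ract]

/-- A continuous linear map `D : A → X` with `D (ab) = a · D b + D a · b`. -/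
def IsDerivation [TopologicalSpace A] (X : TopBimodule A) (D : A →L[ℂ] X.carrier) : Prop :=
  ∀ a b, D (a * b) = X.lact a (D b) + X.ract b (D a)

/-- `D = ad_x` for some `x ∈ X`, that is, `D a = a · x - x · a` for all `a`. -/
def IsInner [TopologicalSpace A] (X : TopBimodule A) (D : A →L[ℂ] X.carrier) : Prop :=
  ∃ x : X.carrier, ∀ a, D a = X.lact a x - X.ract a x

end

variable (A : Type u) [NonUnitalRing A] [Module ℂ A] [IsScalarTower ℂ A A] [SMulCommClass ℂ A A]
  [UniformSpace A] [IsFrechetAlgebra A]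

/-- A Fréchet algebra as a bimodule over itself. -/
noncomputable def regular : TopBimodule A where
  carrier := A
  lact :=
    { toFun := fun a =>
        ⟨LinearMap.mulLeft ℂ a, (IsFrechetAlgebra.continuous_mul_left_right A a).1⟩
      map_add' := fun a b => by ext x; exact add_mul a b x
      map_smul' := fun c a => by ext x; exact smul_mul_assoc c a x }
  ract :=
    { toFun := fun a =>
        ⟨LinearMap.mulRight ℂ a, (IsFrechetAlgebra.continuous_mul_left_right A a).2⟩
      map_add' := fun a b => by ext x; exact mul_add x a b
      map_smul' := fun c a => by ext x; exact mul_smul_comm c x a }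
  lact_mul a b x := mul_assoc a b x
  ract_mul a b x := (mul_assoc x a b).symm
  lact_ract a b x := (mul_assoc a x b).symm

/-- The `n`-th dual bimodule `A^(n)` of a Fréchet algebra, with `A^(0) = A`. -/
noncomputable def iteratedDual : ℕ → TopBimodule A
  | 0 => regular A
  | n + 1 => (iteratedDual n).dual

end TopBimodule

section Amenability

variable (A : Type u) [NonUnitalRing A] [Module ℂ A] [IsScalarTower ℂ A A] [SMulCommClass ℂ A A]
  [UniformSpace A]

/-- `H^1(A, A^(n)) = 0`: every continuous derivation from `A` into its `n`-th dual is inner. -/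
def IsNWeaklyAmenable [IsFrechetAlgebra A] (n : ℕ) : Prop :=
  ∀ D : A →L[ℂ] (TopBimodule.iteratedDual A n).carrier,
    (TopBimodule.iteratedDual A n).IsDerivation D → (TopBimodule.iteratedDual A n).IsInner D

/-- Weak amenability is `1`-weak amenability. -/
def IsWeaklyAmenable [IsFrechetAlgebra A] : Prop := IsNWeaklyAmenable A 1

end Amenability

/-- A two-sided approximate identity consisting of a bounded family, expressed by filters: the
filter of tails of a bounded approximate identity `(e_i)` is such a filter, and conversely. -/
def HasBoundedApproximateIdentity (A : Type u) [NonUnitalRing A] [Module ℂ A]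
    [TopologicalSpace A] : Prop :=
  ∃ l : Filter A, l.IsApproximateUnit ∧ ∃ B ∈ l, Bornology.IsVonNBounded ℂ B

/-! ### Limits of evaluations in the strong bidual, and the bidual embedding. -/

section Functionals

/-! The unit of `A^#` acts as the identity on every dual, so derivations of `A^#` into `(A^#)^(n)`
are derivations of `A` into it. As a topological vector space `(A^#)^(n) = A^(n) ⊕ ℂ`. For even `n`
the first summand is a submodule, for odd `n` the second one is, with zero action. In either case `a
· u = u · a` for the unit vector `u` of `ℂ`, so inner derivations do not see the scalar component.
Two facts about `A` are needed. A functional killing all products is zero; this kills the scalar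
component of a derivation into `(A^#)^(n)`. For odd `n`, a derivation into `A^(n)` lifts only if a
symmetric form `T b a + T a b`, with `T : A → A'` a derivation, equals `φ (a * b)` for some
functional `φ`. Both follow from either hypothesis. -/

open Filter in
/-- Along an ultrafilter containing a bounded set, point evaluations converge to an element of the
strong bidual. -/
theorem exists_tendsto_eval_of_isVonNBounded {E : Type u} [AddCommGroup E] [Module ℂ E]
    [TopologicalSpace E] (l : Ultrafilter E) {B : Set E} (hB : B ∈ l)
    (hb : Bornology.IsVonNBounded ℂ B) :
    ∃ L : StrongDual ℂ (StrongDual ℂ E), ∀ f : StrongDual ℂ E, Tendsto f l (𝓝 (L f)) := by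
  have hlim : ∀ f : StrongDual ℂ E, ∃ z : ℂ, Tendsto f l (𝓝 z) := by
    intro f
    have hbd : Bornology.IsBounded (f '' B) :=
      (NormedSpace.isVonNBounded_iff ℂ).1 (hb.image f)
    have hcomp : IsCompact (closure (f '' B)) := hbd.isCompact_closure
    obtain ⟨z, -, hz⟩ := hcomp.ultrafilter_le_nhds (l.map f) (by
      rw [le_principal_iff]
      exact mem_of_superset (image_mem_map hB) subset_closure)
    exact ⟨z, hz⟩
  choose L hL using hlim
  let Llin : StrongDual ℂ E →ₗ[ℂ] ℂ :=
    { toFun := L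
      map_add' := fun f g => tendsto_nhds_unique (hL (f + g)) ((hL f).add (hL g))
      map_smul' := fun c f => tendsto_nhds_unique (hL (c • f)) ((hL f).const_smul c) }
  refine ⟨⟨Llin, ?_⟩, hL⟩
  refine continuous_of_continuousAt_zero Llin ?_
  rw [ContinuousAt, map_zero, Metric.nhds_basis_closedBall.tendsto_right_iff]
  intro ε hε
  -- Functionals near zero map `B` into the closed ball, which contains their limit along `l`.
  filter_upwards [ContinuousLinearMap.eventually_nhds_zero_mapsTo hb
    (Metric.closedBall_mem_nhds (0 : ℂ) hε)] with f hf
  exact Metric.isClosed_closedBall.mem_of_tendsto (hL f) (mem_of_superset hB hf)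

/-- Evaluation at a vector, as a continuous functional on the strong dual. -/
noncomputable def evalStrongDual {E : Type u} [AddCommGroup E] [Module ℂ E] [TopologicalSpace E]
    [ContinuousSMul ℂ E] (x : E) : StrongDual ℂ (StrongDual ℂ E) where
  toFun f := f x
  map_add' _ _ := rfl
  map_smul' _ _ := rfl
  cont := continuous_eval_const x

/-- A linear map into a strong dual is continuous if small vectors are mapped to functionals which
are uniformly small on bounded sets. -/
theorem continuous_strongDual_of_eventually_mapsTo {E F : Type u} [AddCommGroup E] [Module ℂ E]
    [TopologicalSpace E] [IsTopologicalAddGroup E] [AddCommGroup F] [Module ℂ F]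
    [TopologicalSpace F] (T : E →ₗ[ℂ] StrongDual ℂ F)
    (hT : ∀ S : Set F, Bornology.IsVonNBounded ℂ S → ∀ U ∈ 𝓝 (0 : ℂ),
      ∀ᶠ x in 𝓝 0, ∀ f ∈ S, T x f ∈ U) : Continuous T := by
  refine continuous_of_continuousAt_zero T ?_
  rw [ContinuousAt, map_zero, ContinuousLinearMap.hasBasis_nhds_zero.tendsto_right_iff]
  exact fun SU hSU => hT SU.1 hSU.1 SU.2 hSU.2

/-- The canonical map of a barrelled space into its strong bidual. -/
noncomputable def bidualInclusion (E : Type u) [AddCommGroup E] [Module ℂ E] [UniformSpace E]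
    [IsUniformAddGroup E] [ContinuousSMul ℂ E] [BarrelledSpace ℂ E] :
    E →L[ℂ] StrongDual ℂ (StrongDual ℂ E) where
  toFun := evalStrongDual
  map_add' x y := by ext f; exact map_add f x y
  map_smul' c x := by ext f; exact map_smul f c x
  cont := by
    refine continuous_strongDual_of_eventually_mapsTo
      { toFun := evalStrongDual
        map_add' := fun x y => by ext f; exact map_add f x y
        map_smul' := fun c x => by ext f; exact map_smul f c x } fun S hS U hU => ?_
    -- A strongly bounded set of functionals is pointwise bounded, hence equicontinuous as `E` is
    -- barrelled.
    have hequi : UniformEquicontinuous ((↑) ∘ fun f : S => (f : StrongDual ℂ E)) := by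
      refine PolynormableSpace.banach_steinhaus fun x => ?_
      refine (ContinuousLinearMap.isVonNBounded_image2_apply hS
        (Bornology.isVonNBounded_singleton (𝕜 := ℂ) x)).subset ?_
      rintro _ ⟨f, rfl⟩
      exact ⟨f, f.2, x, rfl, rfl⟩
    obtain ⟨ε, hε, hU⟩ := Metric.mem_nhds_iff.1 hU
    filter_upwards [Metric.equicontinuousAt_iff_right.1 (hequi.equicontinuous 0) ε hε]
      with x hx f hf
    refine hU ?_
    have := hx ⟨f, hf⟩
    rw [dist_comm] at this
    rw [mem_ball_zero_iff]
    simpa [evalStrongDual] using this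

end Functionals

/-! ### The two consequences of either hypothesis on `A`. -/

section FrechetAlgebra

variable (A : Type u) [NonUnitalRing A] [Module ℂ A] [UniformSpace A]

instance IsFrechetAlgebra.barrelledSpace [IsFrechetAlgebra A] : BarrelledSpace ℂ A := by
  obtain ⟨p, -, -, hp⟩ := IsFrechetAlgebra.exists_seminorms (A := A)
  have := hp.firstCountableTopology
  have : (uniformity A).IsCountablyGenerated :=
    IsUniformAddGroup.uniformity_countably_generated
  infer_instance

variable {A}

theorem HasBoundedApproximateIdentity.eq_zero_of_map_mul (hA : HasBoundedApproximateIdentity A)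
    (φ : StrongDual ℂ A) (hφ : ∀ a b, φ (a * b) = 0) : φ = 0 := by
  obtain ⟨l, hl, -⟩ := hA
  have := hl.neBot
  ext a
  have h := (φ.continuous.tendsto a).comp (hl.tendsto_mul_left a)
  have h0 : φ ∘ (fun x => a * x) = fun _ => 0 := funext fun x => hφ a x
  rw [h0] at h
  exact tendsto_nhds_unique h tendsto_const_nhds

variable [IsScalarTower ℂ A A] [SMulCommClass ℂ A A] [IsFrechetAlgebra A]

/-- The map `a ↦ φ a • φ` is a derivation, since every term of the product rule vanishes; being
inner forces `φ a * φ a = 0`. -/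
theorem IsWeaklyAmenable.eq_zero_of_map_mul (hA : IsWeaklyAmenable A) (φ : StrongDual ℂ A)
    (hφ : ∀ a b, φ (a * b) = 0) : φ = 0 := by
  let D : A →L[ℂ] StrongDual ℂ A := φ.smulRight φ
  have hD : (TopBimodule.iteratedDual A 1).IsDerivation D := by
    intro a b
    refine ContinuousLinearMap.ext fun (c : A) => ?_
    change φ (a * b) * φ c = φ b * φ (c * a) + φ a * φ (b * c)
    simp [hφ]
  obtain ⟨(g : StrongDual ℂ A), hg⟩ := hA D hD
  ext a
  have h : φ a * φ a = g (a * a) - g (a * a) := DFunLike.congr_fun (F := StrongDual ℂ A) (hg a) a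
  simpa using h

theorem IsWeaklyAmenable.exists_map_mul_eq (hA : IsWeaklyAmenable A)
    (T : A →L[ℂ] StrongDual ℂ A) (hT : (TopBimodule.regular A).dual.IsDerivation T) :
    ∃ φ : StrongDual ℂ A, ∀ a b, φ (a * b) = T b a + T a b := by
  obtain ⟨(g : StrongDual ℂ A), hg⟩ := hA T hT
  -- An inner `T` is antisymmetric as a bilinear form, so the right-hand side vanishes.
  refine ⟨0, fun a b => ?_⟩
  have h : ∀ c d, T c d = g (d * c) - g (c * d) := fun c d =>
    DFunLike.congr_fun (F := StrongDual ℂ A) (hg c) d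
  simp [h]

/-- Take `φ c = lim T c e` along an ultrafilter of approximate units `e`, and pass to the limit in
`T (a * b) e = T b (e * a) + T a (b * e)`. -/
theorem HasBoundedApproximateIdentity.exists_map_mul_eq (hA : HasBoundedApproximateIdentity A)
    (T : A →L[ℂ] StrongDual ℂ A) (hT : (TopBimodule.regular A).dual.IsDerivation T) :
    ∃ φ : StrongDual ℂ A, ∀ a b, φ (a * b) = T b a + T a b := by
  obtain ⟨l, hl, B, hB, hb⟩ := hA
  have := hl.neBot
  have hle : (Ultrafilter.of l : Filter A) ≤ l := Ultrafilter.of_le l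
  obtain ⟨L, hL⟩ := exists_tendsto_eval_of_isVonNBounded (Ultrafilter.of l) (hle hB) hb
  refine ⟨L.comp T, fun a b => tendsto_nhds_unique (hL (T (a * b))) ?_⟩
  have h : ∀ c, T (a * b) c = T b (c * a) + T a (b * c) :=
    fun c => DFunLike.congr_fun (F := StrongDual ℂ A) (hT a b) c
  rw [show (T (a * b) : A → ℂ) = fun c => T b (c * a) + T a (b * c) from funext h]
  exact (((T b).continuous.tendsto a).comp ((hl.tendsto_mul_right a).mono_left hle)).add
    (((T a).continuous.tendsto b).comp ((hl.tendsto_mul_left b).mono_left hle))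

end FrechetAlgebra

/-! ### Reduction from derivations of the unitization to derivations of `A`. -/

namespace Unitization

variable (A : Type u) [NonUnitalRing A] [Module ℂ A] [UniformSpace A]

/-- The projection of the unitization onto the algebra, as a continuous linear map. -/
noncomputable def sndCLM : Unitization ℂ A →L[ℂ] A where
  toLinearMap := Unitization.sndHom ℂ ℂ A
  cont := continuous_snd.comp continuous_induced_dom

/-- The canonical character of the unitization, as a continuous linear map. -/
noncomputable def fstCLM : Unitization ℂ A →L[ℂ] ℂ where
  toFun x := x.fst
  map_add' _ _ := rfl
  map_smul' _ _ := rfl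
  cont := continuous_fst.comp continuous_induced_dom

/-- The inclusion of the algebra into its unitization, as a continuous linear map. -/
noncomputable def inrCLM : A →L[ℂ] Unitization ℂ A where
  toLinearMap := Unitization.inrHom ℂ ℂ A
  cont := continuous_induced_rng.2 (continuous_const.prodMk continuous_id)

end Unitization

namespace TopBimodule

section Restrict

variable {A : Type u} [NonUnitalRing A] [Module ℂ A] [IsScalarTower ℂ A A] [SMulCommClass ℂ A A]

/-- A bimodule over the unitization, regarded as a bimodule over the algebra. -/
noncomputable def restrict (Y : TopBimodule (Unitization ℂ A)) : TopBimodule A where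
  carrier := Y.carrier
  lact := Y.lact ∘ₗ Unitization.inrHom ℂ ℂ A
  ract := Y.ract ∘ₗ Unitization.inrHom ℂ ℂ A
  lact_mul a b x := by
    have h := Y.lact_mul (a : Unitization ℂ A) b x
    rwa [← Unitization.inr_mul] at h
  ract_mul a b x := by
    have h := Y.ract_mul (a : Unitization ℂ A) b x
    rwa [← Unitization.inr_mul] at h
  lact_ract a b x := Y.lact_ract (a : Unitization ℂ A) b x

/-- The unit of the unitization acts as the identity on both sides. -/
def IsUnital (Y : TopBimodule (Unitization ℂ A)) : Prop :=
  ∀ y : Y.carrier, Y.lact 1 y = y ∧ Y.ract 1 y = y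

theorem IsUnital.dual {Y : TopBimodule (Unitization ℂ A)} (h : Y.IsUnital) : Y.dual.IsUnital :=
  fun (f : StrongDual ℂ Y.carrier) => ⟨ContinuousLinearMap.ext fun y => congrArg f (h y).2,
    ContinuousLinearMap.ext fun y => congrArg f (h y).1⟩

theorem IsUnital.lact_eq {Y : TopBimodule (Unitization ℂ A)} (h : Y.IsUnital)
    (x : Unitization ℂ A) (y : Y.carrier) :
    Y.lact x y = x.fst • y + Y.lact (x.snd : Unitization ℂ A) y := by
  have hx : x = x.fst • (1 : Unitization ℂ A) + (x.snd : Unitization ℂ A) := by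
    ext <;> simp
  conv_lhs => rw [hx, map_add, map_smul]
  exact congrArg₂ (· + ·) (congrArg (x.fst • ·) (h y).1) rfl

theorem IsUnital.ract_eq {Y : TopBimodule (Unitization ℂ A)} (h : Y.IsUnital)
    (x : Unitization ℂ A) (y : Y.carrier) :
    Y.ract x y = x.fst • y + Y.ract (x.snd : Unitization ℂ A) y := by
  have hx : x = x.fst • (1 : Unitization ℂ A) + (x.snd : Unitization ℂ A) := by
    ext <;> simp
  conv_lhs => rw [hx, map_add, map_smul]
  exact congrArg₂ (· + ·) (congrArg (x.fst • ·) (h y).2) rfl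

variable [UniformSpace A]

/-- For a unital bimodule, derivations of the unitization are the derivations of the algebra. -/
theorem IsUnital.forall_isInner_iff {Y : TopBimodule (Unitization ℂ A)} (h : Y.IsUnital) :
    (∀ D : Unitization ℂ A →L[ℂ] Y.carrier, Y.IsDerivation D → Y.IsInner D) ↔
      ∀ d : A →L[ℂ] Y.restrict.carrier, Y.restrict.IsDerivation d → Y.restrict.IsInner d := by
  constructor
  · intro H d hd
    let d' : A →L[ℂ] Y.carrier := d
    -- Extend `d` by zero on the unit.
    have hd' : Y.IsDerivation (d'.comp (Unitization.sndCLM A)) := by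
      intro x y
      rw [h.lact_eq, h.ract_eq]
      change d' (x * y).snd = (x.fst • d' y.snd + Y.lact (x.snd : Unitization ℂ A) (d' y.snd)) +
        (y.fst • d' x.snd + Y.ract (y.snd : Unitization ℂ A) (d' x.snd))
      have e : d' (x.snd * y.snd) = Y.lact (x.snd : Unitization ℂ A) (d' y.snd) +
        Y.ract (y.snd : Unitization ℂ A) (d' x.snd) := hd x.snd y.snd
      rw [Unitization.snd_mul, map_add, map_add, map_smul, map_smul, e]
      abel
    obtain ⟨y, hy⟩ := H _ hd'
    exact ⟨y, fun a => hy a⟩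
  · intro H D hD
    have h1 : D 1 = 0 := by
      have := hD 1 1
      rw [(h _).1, (h _).2, one_mul] at this
      simpa using this
    obtain ⟨(y : Y.carrier), hy⟩ := H (D.comp (Unitization.inrCLM A)) (by
      intro a b
      have := hD (a : Unitization ℂ A) b
      rwa [← Unitization.inr_mul] at this)
    refine ⟨y, fun x => ?_⟩
    have hx : x = x.fst • (1 : Unitization ℂ A) + (x.snd : Unitization ℂ A) := by
      ext <;> simp
    have e : D x = D (x.snd : Unitization ℂ A) := by
      conv_lhs => rw [hx, map_add, map_smul, h1, smul_zero, zero_add]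
    rw [e, h.lact_eq, h.ract_eq, add_sub_add_left_eq_sub]
    exact hy x.snd

end Restrict

/-! ### Decompositions `Z = X ⊕ ℂ`, their duals, and transfer of innerness. -/

section Splitting

variable {A : Type u} [NonUnitalRing A] [Module ℂ A]

/-- A topological direct sum decomposition `Z = X ⊕ ℂ`. -/
structure Splitting (X Z : TopBimodule A) where
  proj : Z.carrier →L[ℂ] X.carrier
  incl : X.carrier →L[ℂ] Z.carrier
  unit : Z.carrier
  coeff : StrongDual ℂ Z.carrier
  proj_incl : ∀ x, proj (incl x) = x
  coeff_incl : ∀ x, coeff (incl x) = 0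
  proj_unit : proj unit = 0
  coeff_unit : coeff unit = 1
  incl_proj : ∀ z, incl (proj z) + coeff z • unit = z

/-- The dual decomposition. -/
noncomputable def Splitting.dual {X Z : TopBimodule A} (S : Splitting X Z) :
    Splitting X.dual Z.dual where
  proj := ContinuousLinearMap.precomp ℂ S.incl
  incl := ContinuousLinearMap.precomp ℂ S.proj
  unit := S.coeff
  coeff :=
    { toFun := fun f : StrongDual ℂ Z.carrier => f S.unit
      map_add' := fun _ _ => rfl
      map_smul' := fun _ _ => rfl
      cont := continuous_eval_const (F := StrongDual ℂ Z.carrier) S.unit }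
  proj_incl (f : StrongDual ℂ X.carrier) := ContinuousLinearMap.ext fun x => congrArg f (S.proj_incl x)
  coeff_incl (f : StrongDual ℂ X.carrier) := (congrArg f S.proj_unit).trans (map_zero f)
  proj_unit := ContinuousLinearMap.ext S.coeff_incl
  coeff_unit := S.coeff_unit
  incl_proj f := ContinuousLinearMap.ext fun z => by
    let f' : StrongDual ℂ Z.carrier := f
    change f' (S.incl (S.proj z)) + f' S.unit * S.coeff z = f' z
    conv_rhs => rw [← S.incl_proj z, map_add, map_smul, smul_eq_mul, mul_comm]

theorem Splitting.ext {X Z : TopBimodule A} (S : Splitting X Z) {y z : Z.carrier}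
    (h₁ : S.proj y = S.proj z) (h₂ : S.coeff y = S.coeff z) : y = z := by
  rw [← S.incl_proj y, ← S.incl_proj z, h₁, h₂]

variable [UniformSpace A]

/-- A splitting `Z = X ⊕ ℂ` in which `X` is a submodule and `a` maps the unit to `j a ∈ X`, as
for the even duals of a unitization. -/
structure SubmoduleSplitting (X Z : TopBimodule A) extends Splitting X Z where
  j : A →L[ℂ] X.carrier
  j_mul_left : ∀ a b, j (a * b) = X.lact a (j b)
  j_mul_right : ∀ a b, j (a * b) = X.ract b (j a)
  lact_eq : ∀ a z, Z.lact a z = incl (X.lact a (proj z)) + coeff z • incl (j a)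
  ract_eq : ∀ a z, Z.ract a z = incl (X.ract a (proj z)) + coeff z • incl (j a)

/-- A splitting `Z = X ⊕ ℂ` in which `ℂ` is a submodule with zero action and the components in `ℂ`
of `a · x` and `x · a` are `π x a`, as for the odd duals of a unitization. -/
structure QuotientSplitting (X Z : TopBimodule A) extends Splitting X Z where
  π : X.carrier →L[ℂ] StrongDual ℂ A
  π_lact : ∀ a x c, π (X.lact a x) c = π x (c * a)
  π_ract : ∀ a x c, π (X.ract a x) c = π x (a * c)
  lact_eq : ∀ a z, Z.lact a z = incl (X.lact a (proj z)) + π (proj z) a • unit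
  ract_eq : ∀ a z, Z.ract a z = incl (X.ract a (proj z)) + π (proj z) a • unit

/-- The dual of a splitting with `X` a submodule has `ℂ` as a submodule. -/
noncomputable def SubmoduleSplitting.dual {X Z : TopBimodule A} (S : SubmoduleSplitting X Z) :
    QuotientSplitting X.dual Z.dual where
  toSplitting := S.toSplitting.dual
  π := ContinuousLinearMap.precomp ℂ S.j
  π_lact a (f : StrongDual ℂ X.carrier) c := congrArg f (S.j_mul_right c a).symm
  π_ract a (f : StrongDual ℂ X.carrier) c := congrArg f (S.j_mul_left a c).symm
  lact_eq a f := ContinuousLinearMap.ext fun z => by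
    let f' : StrongDual ℂ Z.carrier := f
    change f' (Z.ract a z) = f' (S.incl (X.ract a (S.proj z))) + f' (S.incl (S.j a)) * S.coeff z
    rw [S.ract_eq, map_add, map_smul, smul_eq_mul, mul_comm]
  ract_eq a f := ContinuousLinearMap.ext fun z => by
    let f' : StrongDual ℂ Z.carrier := f
    change f' (Z.lact a z) = f' (S.incl (X.lact a (S.proj z))) + f' (S.incl (S.j a)) * S.coeff z
    rw [S.lact_eq, map_add, map_smul, smul_eq_mul, mul_comm]

/-- The dual of a splitting with `ℂ` a submodule has `X.dual` as a submodule. -/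
noncomputable def QuotientSplitting.dual [IsUniformAddGroup A] [ContinuousSMul ℂ A]
    [BarrelledSpace ℂ A] {X Z : TopBimodule A} (S : QuotientSplitting X Z) :
    SubmoduleSplitting X.dual Z.dual where
  toSplitting := S.toSplitting.dual
  -- The functional `j a` is `x ↦ π x a`; barrelledness makes it depend continuously on `a`.
  j := (ContinuousLinearMap.precomp ℂ S.π).comp (bidualInclusion A)
  j_mul_left a b := ContinuousLinearMap.ext fun x => (S.π_ract a x b).symm
  j_mul_right a b := ContinuousLinearMap.ext fun x => (S.π_lact b x a).symm
  lact_eq a f := ContinuousLinearMap.ext fun z => by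
    let f' : StrongDual ℂ Z.carrier := f
    change f' (Z.ract a z) = f' (S.incl (X.ract a (S.proj z))) + f' S.unit * S.π (S.proj z) a
    rw [S.ract_eq, map_add, map_smul, smul_eq_mul, mul_comm]
  ract_eq a f := ContinuousLinearMap.ext fun z => by
    let f' : StrongDual ℂ Z.carrier := f
    change f' (Z.lact a z) = f' (S.incl (X.lact a (S.proj z))) + f' S.unit * S.π (S.proj z) a
    rw [S.lact_eq, map_add, map_smul, smul_eq_mul, mul_comm]

theorem SubmoduleSplitting.forall_isInner_iff {X Z : TopBimodule A} (S : SubmoduleSplitting X Z)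
    (hA : ∀ φ : StrongDual ℂ A, (∀ a b, φ (a * b) = 0) → φ = 0) :
    (∀ D : A →L[ℂ] Z.carrier, Z.IsDerivation D → Z.IsInner D) ↔
      ∀ D : A →L[ℂ] X.carrier, X.IsDerivation D → X.IsInner D := by
  constructor
  · intro H D hD
    obtain ⟨z, hz⟩ := H (S.incl.comp D) (by
      intro a b
      simp [S.lact_eq, S.ract_eq, S.proj_incl, S.coeff_incl, hD a b])
    refine ⟨S.proj z, fun a => ?_⟩
    have h := congrArg S.proj (hz a)
    simpa [S.lact_eq, S.ract_eq, S.proj_incl] using h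
  · intro H D hD
    -- Both actions of `A` take values in `X`, so the scalar component of `D` kills products.
    have hc : S.coeff.comp D = 0 := hA _ fun a b => by
      simp [hD a b, S.lact_eq, S.ract_eq, S.coeff_incl]
    have hc' : ∀ a, S.coeff (D a) = 0 := fun a => DFunLike.congr_fun hc a
    obtain ⟨x, hx⟩ := H (S.proj.comp D) (by
      intro a b
      simp [hD a b, S.lact_eq, S.ract_eq, S.proj_incl, hc'])
    refine ⟨S.incl x, fun a => S.ext ?_ ?_⟩
    · have h := hx a
      simpa [S.lact_eq, S.ract_eq, S.proj_incl, S.coeff_incl] using h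
    · simp [hc', S.lact_eq, S.ract_eq, S.coeff_incl]

variable [IsScalarTower ℂ A A] [SMulCommClass ℂ A A]

theorem QuotientSplitting.forall_isInner_iff [IsFrechetAlgebra A] {X Z : TopBimodule A}
    (S : QuotientSplitting X Z)
    (hA : ∀ φ : StrongDual ℂ A, (∀ a b, φ (a * b) = 0) → φ = 0)
    (hT : ∀ T : A →L[ℂ] StrongDual ℂ A, (regular A).dual.IsDerivation T →
      ∃ φ : StrongDual ℂ A, ∀ a b, φ (a * b) = T b a + T a b) :
    (∀ D : A →L[ℂ] Z.carrier, Z.IsDerivation D → Z.IsInner D) ↔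
      ∀ D : A →L[ℂ] X.carrier, X.IsDerivation D → X.IsInner D := by
  constructor
  · intro H D hD
    obtain ⟨φ, hφ⟩ := hT (S.π.comp D) (by
      intro a b
      refine ContinuousLinearMap.ext fun (c : A) => ?_
      change S.π (D (a * b)) c = S.π (D b) (c * a) + S.π (D a) (b * c)
      rw [hD a b, map_add, add_apply, S.π_lact, S.π_ract])
    -- The scalar component of the product rule for `incl ∘ D` is off by `π (D b) a + π (D a) b`;
    -- adding `φ` as scalar component corrects it.
    obtain ⟨z, hz⟩ := H (S.incl.comp D + φ.smulRight S.unit) (by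
      intro a b
      have h := hφ a b
      simp only [ContinuousLinearMap.comp_apply] at h
      simp [S.lact_eq, S.ract_eq, S.proj_incl, S.proj_unit, hD a b, h, add_smul]
      abel)
    refine ⟨S.proj z, fun a => ?_⟩
    have h := congrArg S.proj (hz a)
    simpa [S.lact_eq, S.ract_eq, S.proj_incl, S.proj_unit] using h
  · intro H D hD
    obtain ⟨x, hx⟩ := H (S.proj.comp D) (by
      intro a b
      simp [hD a b, S.lact_eq, S.ract_eq, S.proj_incl, S.proj_unit])
    have hx' : ∀ a, S.proj (D a) = X.lact a x - X.ract a x := hx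
    -- On `a * b` the scalar component is `π (proj (D b)) a + π (proj (D a)) b`. With `proj ∘ D`
    -- implemented by `x`, these are opposite commutator terms of `π x` and cancel.
    have hc : S.coeff.comp D = 0 := hA _ fun a b => by
      simp [hD a b, S.lact_eq, S.ract_eq, S.coeff_incl, S.coeff_unit, hx', S.π_lact, S.π_ract]
    have hc' : ∀ a, S.coeff (D a) = 0 := fun a => DFunLike.congr_fun hc a
    refine ⟨S.incl x, fun a => S.ext ?_ ?_⟩
    · simp [hx', S.lact_eq, S.ract_eq, S.proj_incl]
    · simp [hc', S.lact_eq, S.ract_eq, S.coeff_incl]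

end Splitting

/-! ### The splittings of the iterated duals, and the theorem. -/

section IteratedDual

variable (A : Type u) [NonUnitalRing A] [Module ℂ A] [IsScalarTower ℂ A A] [SMulCommClass ℂ A A]
  [UniformSpace A] [IsFrechetAlgebra A]

theorem isUnital_iteratedDual (n : ℕ) : (iteratedDual (Unitization ℂ A) n).IsUnital := by
  induction n with
  | zero => exact fun y => ⟨one_mul (M := Unitization ℂ A) y, mul_one (M := Unitization ℂ A) y⟩
  | succ n ih => exact ih.dual

/-- The decomposition `A^# = A ⊕ ℂ e`. -/
noncomputable def regularSplitting :
    SubmoduleSplitting (regular A) (regular (Unitization ℂ A)).restrict where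
  proj := Unitization.sndCLM A
  incl := Unitization.inrCLM A
  unit := (1 : Unitization ℂ A)
  coeff := Unitization.fstCLM A
  proj_incl x := Unitization.snd_inr ℂ x
  coeff_incl x := Unitization.fst_inr ℂ x
  proj_unit := Unitization.snd_one (R := ℂ) (A := A)
  coeff_unit := Unitization.fst_one (R := ℂ) (A := A)
  incl_proj (z : Unitization ℂ A) := by
    change (z.snd : Unitization ℂ A) + z.fst • (1 : Unitization ℂ A) = z
    ext <;> simp
  j := ContinuousLinearMap.id ℂ A
  j_mul_left _ _ := rfl
  j_mul_right _ _ := rfl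
  lact_eq a (z : Unitization ℂ A) := by
    change (a : Unitization ℂ A) * z = ((a * z.snd : A) : Unitization ℂ A) +
      z.fst • (a : Unitization ℂ A)
    ext <;> simp [add_comm]
  ract_eq a (z : Unitization ℂ A) := by
    change z * (a : Unitization ℂ A) = ((z.snd * a : A) : Unitization ℂ A) +
      z.fst • (a : Unitization ℂ A)
    ext <;> simp [add_comm]

/-- The decomposition of the even duals of the unitization. -/
noncomputable def evenSplitting : (k : ℕ) → SubmoduleSplitting (iteratedDual A (2 * k))
    (iteratedDual (Unitization ℂ A) (2 * k)).restrict
  | 0 => regularSplitting A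
  -- This type-checks because `restrict` commutes with `dual` definitionally.
  | k + 1 => (evenSplitting k).dual.dual

end IteratedDual

end TopBimodule

theorem theorem3p20 (A : Type u) [NonUnitalRing A] [Module ℂ A] [IsScalarTower ℂ A A]
    [SMulCommClass ℂ A A] [UniformSpace A] [IsFrechetAlgebra A]
    (hA : IsWeaklyAmenable A ∨ HasBoundedApproximateIdentity A) (n : ℕ) :
    IsNWeaklyAmenable (Unitization ℂ A) n ↔ IsNWeaklyAmenable A n := by
  have hker : ∀ φ : StrongDual ℂ A, (∀ a b, φ (a * b) = 0) → φ = 0 :=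
    hA.elim IsWeaklyAmenable.eq_zero_of_map_mul HasBoundedApproximateIdentity.eq_zero_of_map_mul
  refine (TopBimodule.isUnital_iteratedDual A n).forall_isInner_iff.trans ?_
  obtain ⟨k, rfl | rfl⟩ := n.even_or_odd'
  · exact (TopBimodule.evenSplitting A k).forall_isInner_iff hker
  · exact (TopBimodule.evenSplitting A k).dual.forall_isInner_iff hker
      (hA.elim IsWeaklyAmenable.exists_map_mul_eq
        HasBoundedApproximateIdentity.exists_map_mul_eq)
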